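/- Let $1<\alpha<2$, $\frac1\alpha+\frac1{\alpha'}=1$ and $p\ge\alpha'$. Let $\mathbb D$ be the open unit disc in $\mathbb C$, let $dm$ be area measure on $\mathbb D$, and write $\|F\|_{A^p}=\left(\int_{\mathbb D}|F(z)|^p\,dm(z)\right)^{1/p}\in[0,\infty]$ for the Bergman norm. Then there are constants $0<c,C<\infty$, depending only on $\alpha$ and $p$, such that for every analytic function $F$ on $\mathbb D$ with $F(0)=0$, $$c\,\|F\|_{A^p}^p\;\le\;\inf_{\omega\in S_2}\left(\int_{\mathbb D}|F'(z)|^\alpha\,\omega(z)^\alpha\,dm(z)\right)^{1/\alpha}\;\le\;C\,\|F\|_{A^p}^p,$$ where $S_2=S_2(F)$ is the set of measurable functions $\omega:\mathbb D\to[0,\infty)$ such that $$\int_{\mathbb D}|F'(z)|^{(p-1)\alpha'}\,\omega(z)^{-\alpha'}\,(1-|z|)^{p\alpha'}\,dm(z)\le1.$$ Here all quantities take values in $[0,\infty]$, with $0^{-\alpha'}=\infty$, $0\cdot\infty=0$ and $\inf\emptyset=\infty$; in particular, $F$ belongs to the Bergman space $A^p$ if and only if the infimum is finite. -/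

import Mathlib

open MeasureTheory
open scoped ENNReal NNReal

noncomputable section

/-- Area measure `dm` on the open unit disc, as a measure on `ℂ` carried by the disc. -/
def discArea : Measure ℂ := volume.restrict (Metric.ball (0 : ℂ) 1)

/-- The Bergman norm `(∫_𝔻 |F|^p dm)^{1/p}`, with value `∞` when `F` is not in `A^p`. -/
def bergmanNorm (p : ℝ) (F : ℂ → ℂ) : ℝ≥0∞ := eLpNorm F (ENNReal.ofReal p) discArea

/-- The class of admissible weights: measurable `ω ≥ 0` with
`∫_𝔻 |F'|^{(p-1)α'} ω^{-α'} (1-|z|)^{pα'} dm ≤ 1`. The powers are taken in `[0,∞]`, so that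
`ω(z)^{-α'} = ∞` where `ω(z) = 0`. -/
def admissibleWeights (α' p : ℝ) (F : ℂ → ℂ) : Set (ℂ → ℝ≥0) :=
  {ω | Measurable ω ∧
    ∫⁻ z, ‖deriv F z‖ₑ ^ ((p - 1) * α') * (ω z : ℝ≥0∞) ^ (-α') *
      ENNReal.ofReal (1 - ‖z‖) ^ (p * α') ∂discArea ≤ 1}

/-- The weighted quantity `(∫_𝔻 |F'|^α ω^α dm)^{1/α}`, an element of `[0,∞]`. -/
def weightedNorm (α : ℝ) (F : ℂ → ℂ) (ω : ℂ → ℝ≥0) : ℝ≥0∞ :=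
  (∫⁻ z, ‖deriv F z‖ₑ ^ α * (ω z : ℝ≥0∞) ^ α ∂discArea) ^ (1 / α)

end

/-! Put J = ∫ |F'|^p (1-|z|)^p dm. The infimum over weights is exactly J
(`iInf_weightedNorm_eq_derivEnergy`): Hölder's inequality with exponents α, α' bounds every weighted
norm below by J, and an explicit weight attains equality.

It remains to compare J with ∫ |F|^p dm. For J ≲ ∫ |F|^p (`derivEnergy_le`), Cauchy's formula on the
circle of radius (1-|z|)/2 about z bounds (1-|z|)|F'(z)| by an integral of |F| over that circle;
Tonelli and a change of variables in z finish. For the converse (`lintegral_rpow_le_derivEnergy`), F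
is the integral of F' along rays from 0, and a weighted Hardy inequality is applied on each ray.
Only the Hardy step needs p > 2, which follows from α < 2 and p ≥ α'. -/

/-- The Littlewood-Paley integral `∫_𝔻 |F'|^p (1-|z|)^p dm`. -/
noncomputable def derivEnergy (p : ℝ) (F : ℂ → ℂ) : ℝ≥0∞ :=
  ∫⁻ z, ‖deriv F z‖ₑ ^ p * ENNReal.ofReal (1 - ‖z‖) ^ p ∂discArea

/-! ### Hölder duality: the infimum over weights is `derivEnergy` -/

lemma ae_discArea_norm_lt_one : ∀ᵐ z ∂discArea, ‖z‖ < 1 := by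
  filter_upwards [ae_restrict_mem (measurableSet_ball (x := (0 : ℂ)) (ε := 1))] with z hz
  simpa using hz

lemma measurable_enorm_deriv (F : ℂ → ℂ) : Measurable fun z => ‖deriv F z‖ₑ :=
  (measurable_deriv F).enorm

lemma measurable_ofReal_one_sub_norm : Measurable fun z : ℂ => ENNReal.ofReal (1 - ‖z‖) := by
  fun_prop

/-- Hölder applied to (|F'| ω) · (|F'|^(p-1) ω⁻¹ (1-|z|)^p); the constraint says that the second
factor has L^α' norm at most 1. -/
lemma derivEnergy_le_weightedNorm {α α' p : ℝ} (h : α.HolderConjugate α') (hp : 1 < p)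
    {F : ℂ → ℂ} {ω : ℂ → ℝ≥0} (hω : ω ∈ admissibleWeights α' p F) :
    derivEnergy p F ≤ weightedNorm α F ω := by
  obtain ⟨hm, hle⟩ := hω
  have hD := measurable_enorm_deriv F
  have hd := measurable_ofReal_one_sub_norm
  have hα' : 0 < α' := h.symm.pos
  have hω' : Measurable fun z => (ω z : ℝ≥0∞) := hm.coe_nnreal_ennreal
  -- A finite constraint integral forces ω ≠ 0 almost everywhere on {F' ≠ 0}, so that ω · ω⁻¹ = 1
  -- may be used there.
  have hfin := ae_lt_top (((hD.pow_const ((p - 1) * α')).mul (hω'.pow_const (-α'))).mul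
    (hd.pow_const (p * α'))) (hle.trans_lt ENNReal.one_lt_top).ne
  calc derivEnergy p F
      ≤ ∫⁻ z, ((fun z => ‖deriv F z‖ₑ * ω z) * fun z => ‖deriv F z‖ₑ ^ (p - 1) * (ω z : ℝ≥0∞)⁻¹ *
          ENNReal.ofReal (1 - ‖z‖) ^ p) z ∂discArea := by
        refine lintegral_mono_ae ?_
        filter_upwards [ae_discArea_norm_lt_one, hfin] with z hz hlt
        have hz' : ENNReal.ofReal (1 - ‖z‖) ≠ 0 := by simpa using hz
        by_cases hDz : ‖deriv F z‖ₑ = 0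
        · simp [hDz, ENNReal.zero_rpow_of_pos (zero_lt_one.trans hp)]
        have hDt : ‖deriv F z‖ₑ ≠ ∞ := enorm_ne_top
        by_cases hw : ω z = 0
        · exfalso
          rw [Pi.mul_apply, Pi.mul_apply, hw, ENNReal.coe_zero,
            ENNReal.zero_rpow_of_neg (by linarith), ENNReal.mul_top, ENNReal.top_mul] at hlt
          · exact lt_irrefl _ hlt
          · simp [ENNReal.rpow_eq_zero_iff, hz']
          · simp [ENNReal.rpow_eq_zero_iff, hDz, hDt]
        · have hw0 : (ω z : ℝ≥0∞) ≠ 0 := by simpa using hw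
          have e : ‖deriv F z‖ₑ ^ p = ‖deriv F z‖ₑ * ‖deriv F z‖ₑ ^ (p - 1) := by
            nth_rw 2 [← ENNReal.rpow_one ‖deriv F z‖ₑ]
            rw [← ENNReal.rpow_add _ _ hDz hDt]; congr 1; ring
          have c : (ω z : ℝ≥0∞) * (ω z : ℝ≥0∞)⁻¹ = 1 := ENNReal.mul_inv_cancel hw0 (by simp)
          apply le_of_eq
          simp only [Pi.mul_apply]
          calc _ = ‖deriv F z‖ₑ * ‖deriv F z‖ₑ ^ (p - 1) * ENNReal.ofReal (1 - ‖z‖) ^ p *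
                ((ω z : ℝ≥0∞) * (ω z : ℝ≥0∞)⁻¹) := by rw [c, e, mul_one]
            _ = _ := by ring
    _ ≤ _ := ENNReal.lintegral_mul_le_Lp_mul_Lq _ h (hD.mul hω').aemeasurable
        (((hD.pow_const _).mul hω'.inv).mul (hd.pow_const _)).aemeasurable
    _ ≤ weightedNorm α F ω * 1 := by
        gcongr
        · refine ENNReal.rpow_le_rpow (le_of_eq ?_) (by have := h.pos; positivity)
          refine lintegral_congr fun z => ?_
          rw [ENNReal.mul_rpow_of_nonneg _ _ h.nonneg]
        · refine ENNReal.rpow_le_one ((le_of_eq ?_).trans hle) (by positivity)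
          refine lintegral_congr fun z => ?_
          rw [ENNReal.mul_rpow_of_nonneg _ _ hα'.le, ENNReal.mul_rpow_of_nonneg _ _ hα'.le,
            ← ENNReal.rpow_mul, ← ENNReal.rpow_mul, ENNReal.inv_rpow, ENNReal.rpow_neg]
    _ = _ := mul_one _

/-- The weight `K |F'|^{p/α-1} (1-|z|)^{p/α}`, for which Hölder's inequality is an equality. -/
noncomputable def extremalWeight (α p : ℝ) (F : ℂ → ℂ) (K : ℝ≥0) (z : ℂ) : ℝ≥0 :=
  K * ‖deriv F z‖₊ ^ (p / α - 1) * (1 - ‖z‖).toNNReal ^ (p / α)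

lemma measurable_extremalWeight (α p : ℝ) (F : ℂ → ℂ) (K : ℝ≥0) :
    Measurable (extremalWeight α p F K) := by
  have := (measurable_deriv F).nnnorm
  unfold extremalWeight
  fun_prop

lemma extremalWeight_constraint_integrand {α α' p : ℝ} (h : α.HolderConjugate α') (hp : 1 < p)
    (F : ℂ → ℂ) {K : ℝ≥0} (hK : K ≠ 0) {z : ℂ} (hz : ‖z‖ < 1) :
    ‖deriv F z‖ₑ ^ ((p - 1) * α') * (extremalWeight α p F K z : ℝ≥0∞) ^ (-α') *
      ENNReal.ofReal (1 - ‖z‖) ^ (p * α') =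
    (K : ℝ≥0∞) ^ (-α') * (‖deriv F z‖ₑ ^ p * ENNReal.ofReal (1 - ‖z‖) ^ p) := by
  have hα' : 0 < α' := h.symm.pos
  by_cases hD : ‖deriv F z‖₊ = 0
  · have : ‖deriv F z‖ₑ = 0 := by simpa using hD
    rw [this, ENNReal.zero_rpow_of_pos (mul_pos (by linarith) hα'),
      ENNReal.zero_rpow_of_pos (by linarith)]
    simp
  have hd : (1 - ‖z‖).toNNReal ≠ 0 := by simpa using hz
  have hw : extremalWeight α p F K z ≠ 0 := by
    simp [extremalWeight, NNReal.rpow_eq_zero_iff, hK, hD, hd]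
  change (‖deriv F z‖₊ : ℝ≥0∞) ^ _ * _ * ((1 - ‖z‖).toNNReal : ℝ≥0∞) ^ _ =
    _ * ((‖deriv F z‖₊ : ℝ≥0∞) ^ _ * ((1 - ‖z‖).toNNReal : ℝ≥0∞) ^ _)
  rw [← ENNReal.coe_rpow_of_ne_zero hD, ← ENNReal.coe_rpow_of_ne_zero hd,
    ← ENNReal.coe_rpow_of_ne_zero hD, ← ENNReal.coe_rpow_of_ne_zero hd,
    ← ENNReal.coe_rpow_of_ne_zero hK, ← ENNReal.coe_rpow_of_ne_zero hw]
  norm_cast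
  unfold extremalWeight
  have k : α⁻¹ * α' = α' - 1 := by
    have := h.inv_add_inv_eq_one
    have h1 : α'⁻¹ * α' = 1 := inv_mul_cancel₀ hα'.ne'
    linear_combination α' * this - h1
  have e1 : (p - 1) * α' + (p / α - 1) * -α' = p := by
    linear_combination -p * k
  have e2 : p / α * -α' + p * α' = p := by
    linear_combination -p * k
  rw [NNReal.mul_rpow, NNReal.mul_rpow, ← NNReal.rpow_mul, ← NNReal.rpow_mul]
  calc _ = K ^ (-α') * ((‖deriv F z‖₊ ^ ((p - 1) * α') * ‖deriv F z‖₊ ^ ((p / α - 1) * -α')) *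
        ((1 - ‖z‖).toNNReal ^ (p / α * -α') * (1 - ‖z‖).toNNReal ^ (p * α'))) := by ring
    _ = _ := by rw [← NNReal.rpow_add hD, ← NNReal.rpow_add hd, e1, e2]

lemma extremalWeight_norm_integrand {α p : ℝ} (hα : 1 < α) (hp : 1 < p)
    (F : ℂ → ℂ) (K : ℝ≥0) (z : ℂ) :
    ‖deriv F z‖ₑ ^ α * (extremalWeight α p F K z : ℝ≥0∞) ^ α =
    (K : ℝ≥0∞) ^ α * (‖deriv F z‖ₑ ^ p * ENNReal.ofReal (1 - ‖z‖) ^ p) := by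
  have hα0 : 0 < α := by linarith
  by_cases hD : ‖deriv F z‖₊ = 0
  · have : ‖deriv F z‖ₑ = 0 := by simpa using hD
    rw [this, ENNReal.zero_rpow_of_pos hα0, ENNReal.zero_rpow_of_pos (by linarith)]
    simp
  change (‖deriv F z‖₊ : ℝ≥0∞) ^ _ * _ =
    _ * ((‖deriv F z‖₊ : ℝ≥0∞) ^ _ * ((1 - ‖z‖).toNNReal : ℝ≥0∞) ^ _)
  have hp0 : 0 ≤ p := by linarith
  simp only [← ENNReal.coe_rpow_of_nonneg _ hα0.le, ← ENNReal.coe_rpow_of_nonneg _ hp0]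
  norm_cast
  unfold extremalWeight
  have e1 : α + (p / α - 1) * α = p := by field_simp; ring
  have e2 : p / α * α = p := by field_simp
  rw [NNReal.mul_rpow, NNReal.mul_rpow, ← NNReal.rpow_mul, ← NNReal.rpow_mul, e2]
  calc _ = K ^ α * ((‖deriv F z‖₊ ^ α * ‖deriv F z‖₊ ^ ((p / α - 1) * α)) *
        (1 - ‖z‖).toNNReal ^ p) := by ring
    _ = _ := by rw [← NNReal.rpow_add hD, e1]

lemma exists_admissibleWeight {α α' p : ℝ} (h : α.HolderConjugate α') (hp : 1 < p)
    {F : ℂ → ℂ} (hJ : derivEnergy p F ≠ ∞) :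
    ∃ ω ∈ admissibleWeights α' p F, weightedNorm α F ω ≤ derivEnergy p F := by
  have hm : Measurable fun z => ‖deriv F z‖ₑ ^ p * ENNReal.ofReal (1 - ‖z‖) ^ p :=
    ((measurable_enorm_deriv F).pow_const _).mul (measurable_ofReal_one_sub_norm.pow_const _)
  have hα' : 0 < α' := h.symm.pos
  -- K = 0 is excluded because 0^(-α') = ∞ would break the constraint.
  have key (K : ℝ≥0) (hK : K ≠ 0) (h1 : (K : ℝ≥0∞) ^ (-α') * derivEnergy p F ≤ 1) :
      ∃ ω ∈ admissibleWeights α' p F,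
        weightedNorm α F ω ≤ K * derivEnergy p F ^ (1 / α) := by
    refine ⟨extremalWeight α p F K, ⟨measurable_extremalWeight α p F K, ?_⟩, le_of_eq ?_⟩
    · rw [derivEnergy, ← lintegral_const_mul _ hm] at h1
      refine (le_of_eq (lintegral_congr_ae ?_)).trans h1
      filter_upwards [ae_discArea_norm_lt_one] with z hz
      exact extremalWeight_constraint_integrand h hp F hK hz
    · rw [weightedNorm, lintegral_congr fun z => extremalWeight_norm_integrand h.lt hp F K z,
        lintegral_const_mul _ hm, ENNReal.mul_rpow_of_nonneg _ _ (by have := h.pos; positivity),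
        ← ENNReal.rpow_mul, mul_one_div_cancel h.ne_zero, ENNReal.rpow_one, derivEnergy]
  by_cases h0 : derivEnergy p F = 0
  · obtain ⟨ω, hω, hle⟩ := key 1 one_ne_zero (by simp [h0])
    refine ⟨ω, hω, hle.trans ?_⟩
    rw [h0, ENNReal.zero_rpow_of_pos (by have := h.pos; positivity), mul_zero]
  · lift derivEnergy p F to ℝ≥0 using hJ with J
    have hJ0 : J ≠ 0 := by simpa using h0
    -- K = J^(1/α') makes the constraint an equality, and K J^(1/α) = J.
    have hK : J ^ (1 / α') ≠ 0 := by simp [NNReal.rpow_eq_zero_iff, hJ0]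
    obtain ⟨ω, hω, hle⟩ := key (J ^ (1 / α')) hK (by
      rw [← ENNReal.coe_rpow_of_ne_zero hK, ← NNReal.rpow_mul,
        show 1 / α' * -α' = -1 by field_simp, NNReal.rpow_neg_one]
      norm_cast
      rw [inv_mul_cancel₀ hJ0])
    refine ⟨ω, hω, hle.trans (le_of_eq ?_)⟩
    rw [← ENNReal.coe_rpow_of_ne_zero hJ0, ← ENNReal.coe_mul, ← NNReal.rpow_add hJ0, add_comm]
    have := h.inv_add_inv_eq_one
    rw [one_div, one_div, this, NNReal.rpow_one]

lemma iInf_weightedNorm_eq_derivEnergy {α α' p : ℝ} (h : α.HolderConjugate α') (hp : 1 < p)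
    (F : ℂ → ℂ) :
    (⨅ ω ∈ admissibleWeights α' p F, weightedNorm α F ω) = derivEnergy p F := by
  refine le_antisymm ?_ (le_iInf₂ fun ω hω => derivEnergy_le_weightedNorm h hp hω)
  by_cases hJ : derivEnergy p F = ∞
  · simp [hJ]
  obtain ⟨ω, hω, hle⟩ := exists_admissibleWeight h hp hJ
  exact (iInf₂_le ω hω).trans hle

/-! ### Bounding the derivative by the function: Cauchy estimates on circles -/

/-- Hölder's inequality for the Lebesgue integral, raised to the power `p`. -/
lemma lintegral_mul_rpow_le {X : Type*} [MeasurableSpace X] (μ : Measure X) {p q : ℝ}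
    (h : p.HolderConjugate q) {f g : X → ℝ≥0∞} (hf : AEMeasurable f μ) (hg : AEMeasurable g μ) :
    (∫⁻ x, f x * g x ∂μ) ^ p ≤ (∫⁻ x, f x ^ p ∂μ) * (∫⁻ x, g x ^ q ∂μ) ^ (p - 1) := by
  calc (∫⁻ x, f x * g x ∂μ) ^ p
      ≤ ((∫⁻ x, f x ^ p ∂μ) ^ (1 / p) * (∫⁻ x, g x ^ q ∂μ) ^ (1 / q)) ^ p :=
        ENNReal.rpow_le_rpow (ENNReal.lintegral_mul_le_Lp_mul_Lq μ h hf hg) h.nonneg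
    _ = _ := by
        have := h.inv_add_inv_eq_one
        have hp := h.ne_zero
        rw [ENNReal.mul_rpow_of_nonneg _ _ h.nonneg, ← ENNReal.rpow_mul, ← ENNReal.rpow_mul,
          one_div_mul_cancel hp, ENNReal.rpow_one]
        congr 2
        have h1 : p⁻¹ * p = 1 := inv_mul_cancel₀ hp
        rw [one_div]
        linear_combination p * this - h1

/-- An antilipschitz map of the plane distorts area by at most the square of its constant. -/
lemma AntilipschitzWith.volume_preimage_le {K : ℝ≥0} {T : ℂ → ℂ} (hT : AntilipschitzWith K T)
    (s : Set ℂ) : volume (T ⁻¹' s) ≤ (K : ℝ≥0∞) ^ 2 * volume s := by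
  -- Area is a constant multiple of two-dimensional Hausdorff measure, which obeys the antilipschitz
  -- bound directly.
  have hH : Measure.IsAddHaarMeasure (Measure.hausdorffMeasure 2 : Measure ℂ) := by
    have := isAddHaarMeasure_hausdorffMeasure (E := ℂ)
    rwa [Complex.finrank_real_complex] at this
  have h := Measure.isAddLeftInvariant_eq_smul (volume : Measure ℂ) (Measure.hausdorffMeasure 2)
  rw [h, Measure.smul_apply, Measure.smul_apply, mul_smul_comm]
  gcongr
  simpa using hT.hausdorffMeasure_preimage_le zero_le_two s

/-- The map is the identity plus a term that is 1/2-Lipschitz in z, so |z-w| ≤ |Tz-Tw| + |z-w|/2. -/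
lemma antilipschitzWith_circleMap_center (θ : ℝ) :
    AntilipschitzWith 2 fun z : ℂ => circleMap z ((1 - ‖z‖) / 2) θ := by
  refine AntilipschitzWith.of_le_mul_dist fun z w => ?_
  have e : z - w = (circleMap z ((1 - ‖z‖) / 2) θ - circleMap w ((1 - ‖w‖) / 2) θ) +
      (((‖z‖ - ‖w‖) / 2 : ℝ) : ℂ) * Complex.exp (θ * Complex.I) := by
    simp only [circleMap]; push_cast; ring
  have h1 := norm_add_le (circleMap z ((1 - ‖z‖) / 2) θ - circleMap w ((1 - ‖w‖) / 2) θ)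
    ((((‖z‖ - ‖w‖) / 2 : ℝ) : ℂ) * Complex.exp (θ * Complex.I))
  rw [← e, norm_mul, Complex.norm_exp_ofReal_mul_I, mul_one, Complex.norm_real, Real.norm_eq_abs,
    abs_div, abs_two] at h1
  have h2 := abs_norm_sub_norm_le z w
  simp only [dist_eq_norm, NNReal.coe_ofNat]
  linarith

/-- The antilipschitz bound replaces a Jacobian computation: the pushforward of area is at most 2²
times area. -/
lemma lintegral_comp_circleMap_center_le (θ : ℝ) {G : ℂ → ℝ≥0∞} (hG : Measurable G) :
    ∫⁻ z, G (circleMap z ((1 - ‖z‖) / 2) θ) ≤ 4 * ∫⁻ z, G z := by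
  have hT : Measurable fun z : ℂ => circleMap z ((1 - ‖z‖) / 2) θ := by
    unfold circleMap; fun_prop
  rw [← lintegral_map hG hT, ← smul_eq_mul, ← lintegral_smul_measure]
  refine lintegral_mono' (Measure.le_iff.2 fun s hs => ?_) le_rfl
  rw [Measure.map_apply hT hs, Measure.smul_apply]
  refine ((antilipschitzWith_circleMap_center θ).volume_preimage_le s).trans (le_of_eq ?_)
  norm_num

/-- Cauchy's formula gives the factor 2πR; it is weakened to 2R, which equals 1-|z| when R =
(1-|z|)/2. -/
lemma enorm_deriv_mul_le_lintegral_circleMap {F : ℂ → ℂ} {z : ℂ} {R : ℝ} (hR : 0 < R)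
    (hF : DifferentiableOn ℂ F (Metric.closedBall z R)) :
    ‖deriv F z‖ₑ * ENNReal.ofReal (2 * R) ≤
      ∫⁻ θ in Set.Ioc 0 (2 * Real.pi), ‖F (circleMap z R θ)‖ₑ := by
  have h := hF.deriv_eq_smul_circleIntegral hR
  have hle : ‖(2 * Real.pi * Complex.I) • deriv F z‖ₑ ≤
      ∫⁻ θ in Set.Ioc 0 (2 * Real.pi), ENNReal.ofReal R⁻¹ * ‖F (circleMap z R θ)‖ₑ := by
    rw [← h, circleIntegral, intervalIntegral.integral_of_le Real.two_pi_pos.le]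
    refine (enorm_integral_le_lintegral_enorm _).trans (lintegral_mono fun θ => le_of_eq ?_)
    rw [enorm_smul, enorm_smul, ← mul_assoc]
    congr 1
    rw [← enorm_mul, ← ofReal_norm]
    congr 1
    rw [norm_mul]
    simp [abs_of_pos hR]
    field_simp
  rw [lintegral_const_mul' _ _ ENNReal.ofReal_ne_top, enorm_smul, ← ofReal_norm] at hle
  simp only [norm_mul, Complex.norm_I, Complex.norm_real, Complex.norm_ofNat, mul_one,
    Real.norm_of_nonneg Real.pi_pos.le] at hle
  calc ‖deriv F z‖ₑ * ENNReal.ofReal (2 * R)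
      ≤ ENNReal.ofReal R * (ENNReal.ofReal (2 * Real.pi) * ‖deriv F z‖ₑ) := by
        rw [← mul_assoc, ← ENNReal.ofReal_mul hR.le, mul_comm]
        gcongr ENNReal.ofReal ?_ * _
        nlinarith [Real.pi_gt_three]
    _ ≤ ENNReal.ofReal R * (ENNReal.ofReal R⁻¹ * _) := by gcongr
    _ = _ := by
        rw [← mul_assoc, ← ENNReal.ofReal_mul hR.le, mul_inv_cancel₀ hR.ne', ENNReal.ofReal_one,
          one_mul]

lemma norm_circleMap_center_lt_one {z : ℂ} (hz : ‖z‖ < 1) (θ : ℝ) :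
    ‖circleMap z ((1 - ‖z‖) / 2) θ‖ < 1 := by
  have h := norm_add_le z (((1 - ‖z‖) / 2 : ℝ) * Complex.exp (θ * Complex.I))
  rw [norm_mul, Complex.norm_exp_ofReal_mul_I, mul_one, Complex.norm_real,
    Real.norm_of_nonneg (by linarith)] at h
  rw [circleMap]
  linarith

/-- Weighted `L^p` bounds for the derivative of an analytic function in a Bergman space. -/
lemma derivEnergy_le {p : ℝ} (hp : 1 < p) :
    ∃ C : ℝ≥0, ∀ F : ℂ → ℂ, AnalyticOnNhd ℂ F (Metric.ball (0 : ℂ) 1) →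
      derivEnergy p F ≤ C * ∫⁻ z, ‖F z‖ₑ ^ p ∂discArea := by
  set S : Set ℝ := Set.Ioc 0 (2 * Real.pi)
  have hS : volume S ≠ ∞ := measure_Ioc_lt_top.ne
  -- Hölder in θ costs |S|^(p-1), the outer θ-integral |S|, and the change of variables 4.
  refine ⟨(volume S ^ (p - 1) * (volume S * 4)).toNNReal, fun F hF => ?_⟩
  rw [ENNReal.coe_toNNReal (by finiteness [sub_nonneg.2 hp.le])]
  obtain ⟨q, hq⟩ : ∃ q, p.HolderConjugate q := ⟨_, Real.HolderConjugate.conjExponent hp⟩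
  have hF0 : ContinuousOn F (Metric.ball 0 1) := hF.continuousOn
  -- Extending |F| by zero gives a measurable function and allows the z-integral to run over the
  -- whole plane.
  set G : ℂ → ℝ≥0∞ := (Metric.ball (0 : ℂ) 1).indicator fun z => ‖F z‖ₑ with hGdef
  have hG : Measurable G := by
    classical
    have h1 : Measurable ((Metric.ball (0 : ℂ) 1).indicator F) := by
      rw [← Set.piecewise_eq_indicator]
      exact hF0.measurable_piecewise continuousOn_const measurableSet_ball
    have : G = fun z => ‖(Metric.ball (0 : ℂ) 1).indicator F z‖ₑ := by
      ext z; rw [enorm_indicator_eq_indicator_enorm]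
    rw [this]; exact h1.enorm
  have hc : Measurable fun x : ℂ × ℝ => circleMap x.1 ((1 - ‖x.1‖) / 2) x.2 := by
    unfold circleMap; fun_prop
  have hpt {z : ℂ} (hz : ‖z‖ < 1) : ‖deriv F z‖ₑ ^ p * ENNReal.ofReal (1 - ‖z‖) ^ p ≤
      volume S ^ (p - 1) * ∫⁻ θ in S, G (circleMap z ((1 - ‖z‖) / 2) θ) ^ p := by
    have hR : 0 < (1 - ‖z‖) / 2 := by linarith
    have hsub : Metric.closedBall z ((1 - ‖z‖) / 2) ⊆ Metric.ball 0 1 := by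
      intro w hw
      rw [Metric.mem_closedBall, dist_eq_norm] at hw
      have := norm_add_le (w - z) z
      rw [sub_add_cancel] at this
      rw [mem_ball_zero_iff]
      linarith
    have h1 := enorm_deriv_mul_le_lintegral_circleMap hR (hF.differentiableOn.mono hsub)
    have h2 : ∫⁻ θ in S, ‖F (circleMap z ((1 - ‖z‖) / 2) θ)‖ₑ =
        ∫⁻ θ in S, G (circleMap z ((1 - ‖z‖) / 2) θ) * 1 := by
      refine lintegral_congr fun θ => ?_
      rw [hGdef, Set.indicator_of_mem (by simpa using norm_circleMap_center_lt_one hz θ), mul_one]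
    rw [h2, mul_div_cancel₀ _ (two_ne_zero' ℝ)] at h1
    have h3 := lintegral_mul_rpow_le (volume.restrict S) hq
      (f := fun θ => G (circleMap z ((1 - ‖z‖) / 2) θ)) (g := fun _ => 1)
      (hG.comp (hc.comp measurable_prodMk_left)).aemeasurable aemeasurable_const
    rw [← ENNReal.mul_rpow_of_nonneg _ _ hq.nonneg]
    refine (ENNReal.rpow_le_rpow h1 hq.nonneg).trans (h3.trans (le_of_eq ?_))
    simp [mul_comm]
  calc derivEnergy p F
      ≤ ∫⁻ z, volume S ^ (p - 1) *
          (∫⁻ θ in S, G (circleMap z ((1 - ‖z‖) / 2) θ) ^ p) ∂discArea := by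
        refine lintegral_mono_ae ?_
        filter_upwards [ae_discArea_norm_lt_one] with z hz using hpt hz
    _ = volume S ^ (p - 1) *
          ∫⁻ z, (∫⁻ θ in S, G (circleMap z ((1 - ‖z‖) / 2) θ) ^ p) ∂discArea :=
        lintegral_const_mul' _ _ (by finiteness [sub_nonneg.2 hp.le])
    _ ≤ volume S ^ (p - 1) * ∫⁻ z, ∫⁻ θ in S, G (circleMap z ((1 - ‖z‖) / 2) θ) ^ p := by
        gcongr; exact Measure.restrict_le_self
    _ = volume S ^ (p - 1) * ∫⁻ θ in S, ∫⁻ z, G (circleMap z ((1 - ‖z‖) / 2) θ) ^ p := by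
        rw [lintegral_lintegral_swap]
        exact ((hG.comp hc).pow_const p).aemeasurable
    _ ≤ volume S ^ (p - 1) * ∫⁻ θ in S, 4 * ∫⁻ z, G z ^ p := by
        gcongr with θ
        exact lintegral_comp_circleMap_center_le θ (hG.pow_const p)
    _ = volume S ^ (p - 1) * (volume S * 4) * ∫⁻ z, G z ^ p := by
        rw [setLIntegral_const]; ring
    _ = _ := by
        congr 1
        rw [discArea, ← lintegral_indicator measurableSet_ball]
        refine lintegral_congr fun z => ?_
        by_cases hz : z ∈ Metric.ball (0 : ℂ) 1
        · simp only [hGdef, Set.indicator_of_mem hz]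
        · simp only [hGdef, Set.indicator_of_notMem hz, ENNReal.zero_rpow_of_pos hq.pos]

/-! ### A weighted Hardy inequality on (0,1) -/

/-- Nonnegativity of u' supplies its integrability, so u' may blow up at the endpoints. -/
lemma lintegral_Ioo_of_hasDerivAt_nonneg {u u' : ℝ → ℝ} {a b : ℝ} (hab : a ≤ b)
    (hc : ContinuousOn u (Set.Icc a b)) (hd : ∀ x ∈ Set.Ioo a b, HasDerivAt u (u' x) x)
    (h0 : ∀ x ∈ Set.Ioo a b, 0 ≤ u' x) :
    ∫⁻ x in Set.Ioo a b, ENNReal.ofReal (u' x) = ENNReal.ofReal (u b - u a) := by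
  have hi := intervalIntegral.integrableOn_deriv_of_nonneg hc hd h0
  rw [← intervalIntegral.integral_eq_sub_of_hasDerivAt_of_le hab hc hd
    ((intervalIntegrable_iff_integrableOn_Ioc_of_le hab).2 hi),
    intervalIntegral.integral_of_le hab, integral_Ioc_eq_integral_Ioo,
    ofReal_integral_eq_lintegral_ofReal (hi.mono_set Set.Ioo_subset_Ioc_self)]
  exact (ae_restrict_mem measurableSet_Ioo).mono h0

/-- The integrand is dominated by the derivative of m⁻¹ ρ^(1-κ) (1-ρ)^(-κ/2), which vanishes at 0
since κ < 1. -/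
lemma lintegral_rpow_mul_one_sub_rpow_le {κ r : ℝ} (h0 : 0 < κ) (h1 : κ < 1) (hr0 : 0 < r)
    (hr : r < 1) :
    ∫⁻ ρ in Set.Ioo 0 r, ENNReal.ofReal (ρ ^ (-κ) * (1 - ρ) ^ (-(1 + κ / 2))) ≤
      ENNReal.ofReal ((κ * (1 - κ) / 2)⁻¹ * (1 - r) ^ (-(κ / 2))) := by
  set m := κ * (1 - κ) / 2
  have hm : 0 < m := by have : 0 < 1 - κ := by linarith
                        positivity
  set u : ℝ → ℝ := fun ρ => m⁻¹ * (ρ ^ (1 - κ) * (1 - ρ) ^ (-(κ / 2)))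
  set u' : ℝ → ℝ := fun ρ => m⁻¹ * ((1 * (1 - κ) * ρ ^ (1 - κ - 1)) * (1 - ρ) ^ (-(κ / 2)) +
    ρ ^ (1 - κ) * (-1 * -(κ / 2) * (1 - ρ) ^ (-(κ / 2) - 1)))
  have hc : ContinuousOn u (Set.Icc 0 r) := by
    refine continuousOn_const.mul ((continuousOn_id.rpow_const fun x _ => Or.inr (by linarith)).mul
      ((continuousOn_const.sub continuousOn_id).rpow_const fun x hx => Or.inl ?_))
    have := hx.2
    exact (sub_pos.2 (this.trans_lt hr)).ne'
  have hd : ∀ x ∈ Set.Ioo 0 r, HasDerivAt u (u' x) x := by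
    intro x hx
    have hx1 : 1 - x ≠ 0 := by linarith [hx.2]
    exact (((hasDerivAt_id x).rpow_const (Or.inl hx.1.ne')).mul
      (((hasDerivAt_id x).const_sub 1).rpow_const (Or.inl hx1))).const_mul _
  have hle : ∀ x ∈ Set.Ioo 0 r, x ^ (-κ) * (1 - x) ^ (-(1 + κ / 2)) ≤ u' x := by
    intro x hx
    have hx0 := hx.1
    have hx1 : 0 < 1 - x := by linarith [hx.2]
    have e1 : x ^ (1 - κ) = x * x ^ (-κ) := by
      rw [sub_eq_add_neg, Real.rpow_add hx0, Real.rpow_one]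
    have e2 : (1 - x) ^ (-(κ / 2)) = (1 - x) * (1 - x) ^ (-(1 + κ / 2)) := by
      nth_rw 2 [← Real.rpow_one (1 - x)]
      rw [← Real.rpow_add hx1]; congr 1; ring
    have e3 : (1 - x) ^ (-(κ / 2) - 1) = (1 - x) ^ (-(1 + κ / 2)) := by congr 1; ring
    have e4 : x ^ (1 - κ - 1) = x ^ (-κ) := by congr 1; ring
    simp only [u']
    rw [e1, e2, e3, e4, le_inv_mul_iff₀ hm]
    have hP : 0 < x ^ (-κ) * (1 - x) ^ (-(1 + κ / 2)) := by positivity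
    -- The right side is a convex combination of 1-κ and κ/2, both at least their product m.
    have : m ≤ (1 - κ) * (1 - x) + κ / 2 * x := by
      simp only [m]
      nlinarith [mul_pos (sub_pos.2 h1) hx1, mul_pos h0 hx0, mul_pos h0 (mul_pos h0 hx0),
        mul_pos h0 (mul_pos (sub_pos.2 h1) hx1), mul_pos (sub_pos.2 h1) (sub_pos.2 h1)]
    calc _ ≤ ((1 - κ) * (1 - x) + κ / 2 * x) * (x ^ (-κ) * (1 - x) ^ (-(1 + κ / 2))) := by gcongr
      _ = _ := by ring
  calc _ ≤ ∫⁻ x in Set.Ioo 0 r, ENNReal.ofReal (u' x) :=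
        setLIntegral_mono' measurableSet_Ioo fun x hx => ENNReal.ofReal_le_ofReal (hle x hx)
    _ = ENNReal.ofReal (u r - u 0) :=
        lintegral_Ioo_of_hasDerivAt_nonneg hr0.le hc hd fun x hx => (hle x hx).trans' (by
          have := hx.1
          have : 0 < 1 - x := by linarith [hx.2]
          positivity)
    _ ≤ _ := by
        refine ENNReal.ofReal_le_ofReal ?_
        have hr1 : 0 < 1 - r := by linarith
        simp only [u]
        rw [Real.zero_rpow (by linarith), zero_mul, mul_zero, sub_zero]
        gcongr
        exact mul_le_of_le_one_left (by positivity) (Real.rpow_le_one hr0.le hr.le (by linarith))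

lemma lintegral_one_sub_rpow_neg_half {ρ : ℝ} (h : ρ < 1) :
    ∫⁻ r in Set.Ioo ρ 1, ENNReal.ofReal ((1 - r) ^ (-(1 / 2) : ℝ)) =
      ENNReal.ofReal (2 * (1 - ρ) ^ (1 / 2 : ℝ)) := by
  have := lintegral_Ioo_of_hasDerivAt_nonneg (u := fun r => -2 * (1 - r) ^ (1 / 2 : ℝ))
    (u' := fun r => (1 - r) ^ (-(1 / 2) : ℝ)) h.le ?_ ?_ ?_
  · rw [this]
    congr 1
    rw [sub_self, Real.zero_rpow (by norm_num)]; ring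
  · refine continuousOn_const.mul
      ((continuousOn_const.sub continuousOn_id).rpow_const fun x hx => Or.inr (by norm_num))
  · intro x hx
    have hx1 : 1 - x ≠ 0 := by linarith [hx.2]
    refine (((hasDerivAt_id x).const_sub 1).rpow_const (p := 1 / 2) (Or.inl hx1)).const_mul (-2)
      |>.congr_deriv ?_
    norm_num
    ring
  · intro x hx
    have : 0 < 1 - x := by linarith [hx.2]
    positivity

lemma lintegral_triangle_swap {φ ψ : ℝ → ℝ≥0∞} (hφ : Measurable φ) (hψ : Measurable ψ) :
    ∫⁻ r in Set.Ioo (0 : ℝ) 1, (∫⁻ ρ in Set.Ioo 0 r, φ ρ) * ψ r =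
      ∫⁻ ρ in Set.Ioo (0 : ℝ) 1, φ ρ * ∫⁻ r in Set.Ioo ρ 1, ψ r := by
  set k : ℝ × ℝ → ℝ≥0∞ := {x : ℝ × ℝ | x.2 < x.1}.indicator fun x => φ x.2 * ψ x.1 with hk
  have hkm : Measurable k :=
    ((hφ.comp measurable_snd).mul (hψ.comp measurable_fst)).indicator
      (measurableSet_lt measurable_snd measurable_fst)
  calc _ = ∫⁻ r in Set.Ioo (0 : ℝ) 1, ∫⁻ ρ in Set.Ioo (0 : ℝ) 1, k (r, ρ) := by
        refine setLIntegral_congr_fun measurableSet_Ioo fun r hr => ?_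
        have e : (fun ρ => k (r, ρ)) = (Set.Iio r).indicator fun ρ => φ ρ * ψ r := by
          ext ρ; simp [hk, Set.indicator]
        simp only [e]
        rw [lintegral_indicator measurableSet_Iio, Measure.restrict_restrict measurableSet_Iio,
          lintegral_mul_const _ hφ]
        congr 3
        ext x; simp only [Set.mem_inter_iff, Set.mem_Iio, Set.mem_Ioo]
        constructor
        · exact fun h => ⟨h.2, h.1, h.2.trans hr.2⟩
        · exact fun h => ⟨h.2.1, h.1⟩
    _ = ∫⁻ ρ in Set.Ioo (0 : ℝ) 1, ∫⁻ r in Set.Ioo (0 : ℝ) 1, k (r, ρ) :=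
        lintegral_lintegral_swap hkm.aemeasurable
    _ = _ := by
        refine setLIntegral_congr_fun measurableSet_Ioo fun ρ hρ => ?_
        have e : (fun r => k (r, ρ)) = (Set.Ioi ρ).indicator fun r => φ ρ * ψ r := by
          ext r; simp [hk, Set.indicator]
        simp only [e]
        rw [lintegral_indicator measurableSet_Ioi, Measure.restrict_restrict measurableSet_Ioi,
          lintegral_const_mul _ hψ]
        congr 3
        ext x; simp only [Set.mem_inter_iff, Set.mem_Ioi, Set.mem_Ioo]
        constructor
        · exact fun h => ⟨h.1, h.2.2⟩
        · exact fun h => ⟨h.1, hρ.1.trans h.1, h.2⟩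

/-- Hölder with multiplier h = ρ^(1/p) (1-ρ)^(1-1/(2p)). The power of ρ makes h^p carry the polar
Jacobian; then h^(-q) behaves like ρ^(-κ) at 0, with κ = 1/(p-1), which is integrable exactly when p
> 2. The power of 1-ρ leaves (1-r)^(-1/2), still integrable in r. -/
lemma lintegral_Ioo_rpow_le {p : ℝ} (hp : 2 < p) {g : ℝ → ℝ≥0∞} (hg : Measurable g) {r : ℝ}
    (hr0 : 0 < r) (hr : r < 1) :
    (∫⁻ ρ in Set.Ioo 0 r, g ρ) ^ p ≤
      (∫⁻ ρ in Set.Ioo 0 r, g ρ ^ p * ENNReal.ofReal (ρ * (1 - ρ) ^ (p - 1 / 2))) *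
        ENNReal.ofReal
          (((1 / (p - 1) * (1 - 1 / (p - 1)) / 2)⁻¹) ^ (p - 1) * (1 - r) ^ (-(1 / 2) : ℝ)) := by
  have hp1 : 0 < p - 1 := by linarith
  have hpos : 0 < p := by linarith
  set κ := 1 / (p - 1) with hκ
  have hκ0 : 0 < κ := by positivity
  have hκ1 : κ < 1 := by rw [hκ, div_lt_one hp1]; linarith
  have hκp : κ * (p - 1) = 1 := by rw [hκ]; field_simp
  have hpq : p.HolderConjugate (1 + κ) := by
    rw [Real.holderConjugate_iff]
    refine ⟨by linarith, ?_⟩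
    have : 1 + κ ≠ 0 := by positivity
    field_simp
    linear_combination -hκp
  set h : ℝ → ℝ := fun ρ => ρ ^ (1 / p) * (1 - ρ) ^ (1 - 1 / (2 * p)) with hh
  have hhm : Measurable h := by fun_prop
  have hhpos : ∀ ρ ∈ Set.Ioo 0 r, 0 < h ρ := fun ρ hρ => by
    have := hρ.1
    have : 0 < 1 - ρ := by linarith [hρ.2]
    positivity
  have hM : 0 ≤ (κ * (1 - κ) / 2)⁻¹ := by
    have : 0 < 1 - κ := by linarith
    positivity
  calc (∫⁻ ρ in Set.Ioo 0 r, g ρ) ^ p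
      = (∫⁻ ρ in Set.Ioo 0 r, (g ρ * ENNReal.ofReal (h ρ)) * ENNReal.ofReal (h ρ)⁻¹) ^ p := by
        congr 1
        refine setLIntegral_congr_fun measurableSet_Ioo fun ρ hρ => ?_
        have := hhpos ρ hρ
        rw [mul_assoc, ← ENNReal.ofReal_mul this.le, mul_inv_cancel₀ this.ne', ENNReal.ofReal_one,
          mul_one]
    _ ≤ _ := lintegral_mul_rpow_le _ hpq (hg.mul hhm.ennreal_ofReal).aemeasurable
        hhm.inv.ennreal_ofReal.aemeasurable
    _ ≤ _ := by
        refine mul_le_mul' (le_of_eq ?_) ?_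
        · refine setLIntegral_congr_fun measurableSet_Ioo fun ρ hρ => ?_
          have h1 := hρ.1
          have h2 : 0 < 1 - ρ := by linarith [hρ.2]
          rw [ENNReal.mul_rpow_of_nonneg _ _ hpos.le,
            ENNReal.ofReal_rpow_of_pos (hhpos ρ hρ)]
          congr 2
          rw [hh]
          simp only
          rw [Real.mul_rpow (by positivity) (by positivity), ← Real.rpow_mul h1.le,
            ← Real.rpow_mul h2.le, one_div_mul_cancel hpos.ne', Real.rpow_one]
          congr 2
          field_simp
        · have e : ∫⁻ ρ in Set.Ioo 0 r, ENNReal.ofReal (h ρ)⁻¹ ^ (1 + κ) =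
              ∫⁻ ρ in Set.Ioo 0 r, ENNReal.ofReal (ρ ^ (-κ) * (1 - ρ) ^ (-(1 + κ / 2))) := by
            refine setLIntegral_congr_fun measurableSet_Ioo fun ρ hρ => ?_
            have h1 := hρ.1
            have h2 : 0 < 1 - ρ := by linarith [hρ.2]
            rw [ENNReal.ofReal_rpow_of_pos (inv_pos.2 (hhpos ρ hρ))]
            congr 1
            rw [hh]
            simp only
            rw [mul_inv, Real.mul_rpow (by positivity) (by positivity), ← Real.rpow_neg h1.le,
              ← Real.rpow_neg h2.le, ← Real.rpow_mul h1.le, ← Real.rpow_mul h2.le]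
            congr 2
            · field_simp
              linear_combination hκp
            · field_simp
              linear_combination -hκp
          rw [e]
          refine (ENNReal.rpow_le_rpow (lintegral_rpow_mul_one_sub_rpow_le hκ0 hκ1 hr0 hr)
            hp1.le).trans (le_of_eq ?_)
          have hr1 : 0 < 1 - r := by linarith
          rw [ENNReal.ofReal_rpow_of_nonneg (by positivity) hp1.le,
            Real.mul_rpow hM (by positivity), ← Real.rpow_mul hr1.le]
          congr 3
          linear_combination -hκp / 2

/-- A weighted Hardy inequality on `(0,1)`. -/
lemma hardy_inequality_Ioo {p : ℝ} (hp : 2 < p) :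
    ∃ C : ℝ≥0, ∀ g : ℝ → ℝ≥0∞, Measurable g →
      ∫⁻ r in Set.Ioo (0 : ℝ) 1, ENNReal.ofReal r * (∫⁻ ρ in Set.Ioo 0 r, g ρ) ^ p ≤
        C * ∫⁻ ρ in Set.Ioo (0 : ℝ) 1,
          ENNReal.ofReal ρ * (g ρ ^ p * ENNReal.ofReal (1 - ρ) ^ p) := by
  set M : ℝ := ((1 / (p - 1) * (1 - 1 / (p - 1)) / 2)⁻¹) ^ (p - 1)
  have hM : 0 ≤ M := by
    have h1 : 0 < p - 1 := by linarith
    have : 0 < 1 - 1 / (p - 1) := by rw [sub_pos, div_lt_one h1]; linarith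
    positivity
  -- M comes from Hölder; 2 comes from ∫_ρ^1 (1-r)^(-1/2) dr = 2(1-ρ)^(1/2), which also restores the
  -- weight (1-ρ)^p.
  refine ⟨(M * 2).toNNReal, fun g hg => ?_⟩
  set φ : ℝ → ℝ≥0∞ := fun ρ => g ρ ^ p * ENNReal.ofReal (ρ * (1 - ρ) ^ (p - 1 / 2)) with hφd
  set ψ : ℝ → ℝ≥0∞ := fun r => ENNReal.ofReal ((1 - r) ^ (-(1 / 2) : ℝ)) with hψd
  have hφ : Measurable φ := by fun_prop
  have hψ : Measurable ψ := by fun_prop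
  change _ ≤ ENNReal.ofReal (M * 2) * _
  calc _ ≤ ∫⁻ r in Set.Ioo (0 : ℝ) 1, ENNReal.ofReal M * ((∫⁻ ρ in Set.Ioo 0 r, φ ρ) * ψ r) := by
        refine setLIntegral_mono' measurableSet_Ioo fun r hr => ?_
        have h1 := lintegral_Ioo_rpow_le hp hg hr.1 hr.2
        rw [ENNReal.ofReal_mul hM] at h1
        -- The Jacobian r on the left is simply discarded; the one on the right is already in φ.
        calc _ ≤ 1 * (∫⁻ ρ in Set.Ioo 0 r, g ρ) ^ p := by
              gcongr
              rw [ENNReal.ofReal_le_one]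
              exact hr.2.le
          _ ≤ _ := by
              rw [one_mul]
              exact h1.trans (le_of_eq (by ring))
    _ = ENNReal.ofReal M * ∫⁻ ρ in Set.Ioo (0 : ℝ) 1, φ ρ * ∫⁻ r in Set.Ioo ρ 1, ψ r := by
        rw [lintegral_const_mul' _ _ ENNReal.ofReal_ne_top, lintegral_triangle_swap hφ hψ]
    _ = _ := by
        rw [ENNReal.ofReal_mul hM, mul_assoc]
        congr 1
        rw [← lintegral_const_mul' _ _ ENNReal.ofReal_ne_top]
        refine setLIntegral_congr_fun measurableSet_Ioo fun ρ hρ => ?_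
        have h1 := hρ.1
        have h2 : 0 < 1 - ρ := by linarith [hρ.2]
        simp only [hφd, hψd]
        rw [lintegral_one_sub_rpow_neg_half hρ.2, mul_assoc, ← ENNReal.ofReal_mul (by positivity),
          ENNReal.ofReal_rpow_of_pos h2]
        have e : ρ * (1 - ρ) ^ (p - 1 / 2) * (2 * (1 - ρ) ^ (1 / 2 : ℝ)) =
            2 * (ρ * (1 - ρ) ^ p) := by
          have : (1 - ρ) ^ p = (1 - ρ) ^ (p - 1 / 2) * (1 - ρ) ^ (1 / 2 : ℝ) := by
            rw [← Real.rpow_add h2]; congr 1; ring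
          rw [this]; ring
        rw [e, ENNReal.ofReal_mul zero_le_two, ENNReal.ofReal_mul h1.le]
        ring

/-! ### Bounding the function by its derivative: polar coordinates and rays -/

lemma lintegral_discArea_eq_polar {f : ℂ → ℝ≥0∞} (hf : Measurable f) :
    ∫⁻ z, f z ∂discArea = ∫⁻ θ in Set.Ioo (-Real.pi) Real.pi, ∫⁻ r in Set.Ioo (0 : ℝ) 1,
      ENNReal.ofReal r * f (r * Complex.exp (θ * Complex.I)) := by
  set k : ℝ × ℝ → ℝ≥0∞ := fun x => ENNReal.ofReal x.1 *
    (Metric.ball (0 : ℂ) 1).indicator f (x.1 * Complex.exp (x.2 * Complex.I)) with hk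
  have hkm : Measurable k := by
    have : Measurable fun x : ℝ × ℝ => (x.1 * Complex.exp (x.2 * Complex.I) : ℂ) := by fun_prop
    exact (ENNReal.measurable_ofReal.comp measurable_fst).mul
      ((hf.indicator measurableSet_ball).comp this)
  rw [discArea, ← lintegral_indicator measurableSet_ball, ← Complex.lintegral_comp_polarCoord_symm]
  calc _ = ∫⁻ x in polarCoord.target, k x := by
        refine lintegral_congr fun x => ?_
        rw [Complex.polarCoord_symm_apply, smul_eq_mul, hk]
        simp only
        rw [Complex.exp_mul_I, Complex.ofReal_cos, Complex.ofReal_sin]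
    _ = ∫⁻ θ in Set.Ioo (-Real.pi) Real.pi, ∫⁻ r in Set.Ioi (0 : ℝ), k (r, θ) := by
        rw [polarCoord_target, Measure.volume_eq_prod, ← Measure.prod_restrict,
          lintegral_prod_symm _ hkm.aemeasurable]
    _ = _ := by
        refine lintegral_congr fun θ => ?_
        have e : ∀ r ∈ Set.Ioi (0 : ℝ), k (r, θ) = (Set.Iio (1 : ℝ)).indicator
            (fun r => ENNReal.ofReal r * f (r * Complex.exp (θ * Complex.I))) r := by
          intro r hr
          have hr' : (r : ℂ) * Complex.exp (θ * Complex.I) ∈ Metric.ball (0 : ℂ) 1 ↔ r < 1 := by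
            rw [mem_ball_zero_iff, norm_mul, Complex.norm_exp_ofReal_mul_I, mul_one,
              Complex.norm_real, Real.norm_of_nonneg (le_of_lt hr)]
          by_cases h : r < 1 <;> simp [hk, Set.indicator, hr', h, -Metric.mem_ball]
        rw [setLIntegral_congr_fun measurableSet_Ioi e, lintegral_indicator measurableSet_Iio,
          Measure.restrict_restrict measurableSet_Iio, Set.inter_comm, Set.Ioi_inter_Iio]

lemma enorm_le_lintegral_deriv_ray {F : ℂ → ℂ} (hF : AnalyticOnNhd ℂ F (Metric.ball (0 : ℂ) 1))
    (h0 : F 0 = 0) {e : ℂ} (he : ‖e‖ = 1) {r : ℝ} (hr0 : 0 < r) (hr : r < 1) :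
    ‖F (r * e)‖ₑ ≤ ∫⁻ ρ in Set.Ioo 0 r, ‖deriv F (ρ * e)‖ₑ := by
  have hmem : ∀ ρ ∈ Set.uIcc 0 r, (ρ : ℂ) * e ∈ Metric.ball (0 : ℂ) 1 := by
    intro ρ hρ
    rw [Set.uIcc_of_le hr0.le] at hρ
    rw [mem_ball_zero_iff, norm_mul, he, mul_one, Complex.norm_real, Real.norm_of_nonneg hρ.1]
    exact hρ.2.trans_lt hr
  have hd : ∀ ρ ∈ Set.uIcc 0 r,
      HasDerivAt (fun ρ : ℝ => F (ρ * e)) (deriv F (ρ * e) * e) ρ := by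
    intro ρ hρ
    have h1 : HasDerivAt (fun ρ : ℝ => (ρ : ℂ) * e) e ρ := by
      simpa using (Complex.ofRealCLM.hasDerivAt (x := ρ)).mul_const e
    exact (hF _ (hmem ρ hρ)).differentiableAt.hasDerivAt.comp ρ h1
  have hc : ContinuousOn (fun ρ : ℝ => deriv F (ρ * e) * e) (Set.uIcc 0 r) :=
    (hF.deriv.continuousOn.comp (by fun_prop) hmem).mul continuousOn_const
  have h := intervalIntegral.integral_eq_sub_of_hasDerivAt hd hc.intervalIntegrable
  simp only [Complex.ofReal_zero, zero_mul, h0, sub_zero] at h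
  rw [← h, intervalIntegral.integral_of_le hr0.le, integral_Ioc_eq_integral_Ioo]
  refine (enorm_integral_le_lintegral_enorm _).trans (le_of_eq (lintegral_congr fun ρ => ?_))
  rw [enorm_mul, ← ofReal_norm e, he, ENNReal.ofReal_one, mul_one]

/-- An analytic function vanishing at `0` is controlled by its derivative in weighted `L^p`. -/
lemma lintegral_rpow_le_derivEnergy {p : ℝ} (hp : 2 < p) :
    ∃ C : ℝ≥0, ∀ F : ℂ → ℂ, AnalyticOnNhd ℂ F (Metric.ball (0 : ℂ) 1) → F 0 = 0 →
      ∫⁻ z, ‖F z‖ₑ ^ p ∂discArea ≤ C * derivEnergy p F := by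
  obtain ⟨C, hC⟩ := hardy_inequality_Ioo hp
  refine ⟨C, fun F hF h0 => ?_⟩
  have hG : Measurable ((Metric.ball (0 : ℂ) 1).indicator F) := by
    classical
    rw [← Set.piecewise_eq_indicator]
    exact hF.continuousOn.measurable_piecewise continuousOn_const measurableSet_ball
  have hm : Measurable fun z => ‖deriv F z‖ₑ ^ p * ENNReal.ofReal (1 - ‖z‖) ^ p :=
    ((measurable_enorm_deriv F).pow_const _).mul (measurable_ofReal_one_sub_norm.pow_const _)
  have hFG : ∫⁻ z, ‖F z‖ₑ ^ p ∂discArea =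
      ∫⁻ z, ‖(Metric.ball (0 : ℂ) 1).indicator F z‖ₑ ^ p ∂discArea :=
    setLIntegral_congr_fun measurableSet_ball fun z hz => by
      simp only [Set.indicator_of_mem hz]
  rw [hFG, derivEnergy, lintegral_discArea_eq_polar (hG.enorm.pow_const p),
    lintegral_discArea_eq_polar hm, ← lintegral_const_mul' _ _ ENNReal.coe_ne_top]
  refine lintegral_mono fun θ => ?_
  have he : ‖Complex.exp (θ * Complex.I)‖ = 1 := Complex.norm_exp_ofReal_mul_I θ
  set e := Complex.exp (θ * Complex.I)
  have hg : Measurable fun ρ : ℝ => ‖deriv F (ρ * e)‖ₑ :=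
    (measurable_enorm_deriv F).comp (by fun_prop)
  have hn {r : ℝ} (hr : r ∈ Set.Ioo (0 : ℝ) 1) : ‖(r : ℂ) * e‖ = r := by
    rw [norm_mul, he, mul_one, Complex.norm_real, Real.norm_of_nonneg hr.1.le]
  calc _ ≤ ∫⁻ r in Set.Ioo (0 : ℝ) 1, ENNReal.ofReal r *
        (∫⁻ ρ in Set.Ioo 0 r, ‖deriv F (ρ * e)‖ₑ) ^ p := by
        refine setLIntegral_mono' measurableSet_Ioo fun r hr => ?_
        rw [Set.indicator_of_mem (by rw [mem_ball_zero_iff, hn hr]; exact hr.2)]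
        gcongr
        exact enorm_le_lintegral_deriv_ray hF h0 he hr.1 hr.2
    _ ≤ _ := hC _ hg
    _ = _ := by
        congr 1
        refine setLIntegral_congr_fun measurableSet_Ioo fun r hr => ?_
        simp only [hn hr]

/-! ### Conclusion -/

theorem theorem3 (α α' p : ℝ) (hα₁ : 1 < α) (hα₂ : α < 2) (hα' : 1 / α + 1 / α' = 1)
    (hp : α' ≤ p) :
    ∃ c C : ℝ≥0, 0 < c ∧ 0 < C ∧
      ∀ F : ℂ → ℂ, AnalyticOnNhd ℂ F (Metric.ball (0 : ℂ) 1) → F 0 = 0 →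
        ((c : ℝ≥0∞) * bergmanNorm p F ^ p ≤
            (⨅ ω ∈ admissibleWeights α' p F, weightedNorm α F ω)) ∧
          ((⨅ ω ∈ admissibleWeights α' p F, weightedNorm α F ω) ≤
            (C : ℝ≥0∞) * bergmanNorm p F ^ p) := by
  have h : α.HolderConjugate α' := by
    rw [Real.holderConjugate_iff]
    exact ⟨hα₁, by simpa only [one_div] using hα'⟩
  -- α < 2 gives α' > 2, hence p > 2 as the Hardy inequality requires.
  have hp2 : 2 < p := by
    have h1 := h.symm.pos
    have h2 : α' + α = α * α' := by
      have := h.ne_zero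
      field_simp at hα'
      linarith
    nlinarith
  obtain ⟨A, hA⟩ := lintegral_rpow_le_derivEnergy hp2
  obtain ⟨B, hB⟩ := derivEnergy_le (p := p) (by linarith)
  have hnorm (F : ℂ → ℂ) : bergmanNorm p F ^ p = ∫⁻ z, ‖F z‖ₑ ^ p ∂discArea := by
    have hp0 : 0 < p := by linarith
    rw [bergmanNorm, eLpNorm_eq_lintegral_rpow_enorm_toReal (by simpa using hp0)
      ENNReal.ofReal_ne_top, ENNReal.toReal_ofReal hp0.le, ← ENNReal.rpow_mul,
      one_div_mul_cancel hp0.ne', ENNReal.rpow_one]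
  -- Adding 1 keeps both constants positive even if A or B is 0.
  refine ⟨(A + 1)⁻¹, B + 1, by positivity, by positivity, fun F hF h0 => ?_⟩
  rw [iInf_weightedNorm_eq_derivEnergy h (by linarith), hnorm]
  constructor
  · rw [ENNReal.coe_inv (by positivity), ENNReal.inv_mul_le_iff (by simp) (by simp)]
    refine (hA F hF h0).trans ?_
    gcongr
    exact le_self_add
  · refine (hB F hF).trans ?_
    gcongr
    exact le_self_add
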